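/- Let $(H,\rho)$ be a complete $\mathrm{CAT}(0)$ space with the geodesic extension property (every nondegenerate unit speed geodesic $[0,L]\to H$, $L>0$, extends to an isometry $\mathbb{R}\to H$). For $p,q\in H$ let $\gamma_{p,q}:[0,1]\to H$ be the constant speed geodesic from $p$ to $q$. Let $S_p$ be the space of directions at $p$, i.e. the metric identification of the set of constant speed geodesics $[0,1]\to H$ issuing from $p$ with respect to the Alexandrov angle $\angle_p$, where the angle between a zero and a nonzero geodesic is $\pi/2$ and the angle of two zero geodesics is $0$; put $\zeta(\gamma)=0$ if $\gamma$ is the zero geodesic and $\zeta(\gamma)=1$ otherwise. Let $T_pH$ be the tangent space, i.e. $[0,\infty)\times S_p$ modulo $(t_1,\gamma_1)\sim(t_2,\gamma_2)$ iff $t_1\zeta(\gamma_1)=t_2\zeta(\gamma_2)=0$, or $t_1\zeta(\gamma_1)=t_2\zeta(\gamma_2)>0$ and $\gamma_1=\gamma_2$. Write $t\gamma$ for the class of $(t,\gamma)$, $0_p$ for the zero vector, and $$d_p(t_1\gamma_1,t_2\gamma_2)=\sqrt{t_1^2\zeta(\gamma_1)+t_2^2\zeta(\gamma_2)-2t_1t_2\zeta(\gamma_1)\zeta(\gamma_2)\cos\angle_p(\gamma_1,\gamma_2)},$$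 $$\|v\|_p=d_p(0_p,v),\qquad g_p(v,w)=\tfrac12\left[\|v\|_p^2+\|w\|_p^2-d_p(v,w)^2\right].$$ Let $A$ be a set-valued vector field on $H$ (that is, $Ap\subset T_pH$ for every $p\in H$), with $\operatorname{dom}A=\{p: Ap\neq\emptyset\}$ and set of stationary points $A^{-1}\mathbf 0=\{p: 0_p\in Ap\}$. Assume that $A$ is monotone, i.e. $g_p(\eta,\gamma_{p,q})\le -g_q(\nu,\gamma_{q,p})$ whenever $\eta\in Ap$, $\nu\in Aq$, and that it satisfies the surjectivity condition: for all $t>0$ and $x\in H$ there is $p\in H$ with $t\rho(p,x)\gamma_{p,x}\in Ap$. For $\lambda>0$ let $J_\lambda x$ be the unique $z\in H$ with $\lambda^{-1}\rho(z,x)\gamma_{z,x}\in Az$, and let $J_0$ be the identity. The semigroup generated by $A$ is $S(t)x=\lim_{k\to\infty}J_{t/k}^k x$ for $t\ge0$ and $x\in\overline{\operatorname{dom}A}$. A bounded sequence $(x^k)$ in $H$ is $\Delta$-convergent to $z$ if for each of its subsequences $(u^k)$ the point $z$ is the asymptotic center, i.e. the minimizer of $y\mapsto\limsup_k\rho(y,u^k)$.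 A curve $(x_t)_{t\ge0}$ is $\Delta$-convergent to $z$ as $t\to\infty$ if $(x_{t_k})$ is $\Delta$-convergent to $z$ for every sequence $t_k\to\infty$ in $[0,\infty)$; and $z$ is a $\Delta$-accumulation point of the curve if $(x_{t_k})$ is $\Delta$-convergent to $z$ for some sequence $t_k\to\infty$. Theorem. Suppose in addition that $A^{-1}\mathbf 0\neq\emptyset$, and let $x\in\overline{\operatorname{dom}A}$. Then the limits $S(t)x$, $t\ge0$, exist and the trajectory $(S(t)x)_{t\ge0}$ is bounded. Moreover, if all $\Delta$-accumulation points of $(S(t)x)_{t\ge0}$ are contained in $A^{-1}\mathbf 0$, then $(S(t)x)_{t\ge0}$ is $\Delta$-convergent to a point of $A^{-1}\mathbf 0$ as $t\to\infty$. -/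

import Mathlib

open Filter Topology Set
open scoped NNReal

namespace Hadamard

noncomputable section

/-! ### Geodesics and CAT(0) spaces -/

/-- `c`, restricted to `[0,1]`, is a normalized (constant speed) geodesic from `p` to `q`.
The values of `c` outside `[0,1]` are irrelevant. -/
def IsGeodesic {X : Type*} [MetricSpace X] (c : ℝ → X) (p q : X) : Prop :=
  c 0 = p ∧ c 1 = q ∧
    ∀ s ∈ Icc (0 : ℝ) 1, ∀ t ∈ Icc (0 : ℝ) 1, dist (c s) (c t) = dist p q * |s - t|

/-- The Euclidean plane. -/
abbrev Plane := EuclideanSpace ℝ (Fin 2)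

/-- The plane triangle with vertices `P, Q, R` is a comparison triangle for `p, q, r`. -/
def IsComparisonTriangle {X : Type*} [MetricSpace X] (p q r : X) (P Q R : Plane) : Prop :=
  dist P Q = dist p q ∧ dist Q R = dist q r ∧ dist R P = dist r p

/-- `u` lies on the geodesic side `c` issuing from `p`, and `U` is its comparison point on the
plane segment from `P` to `Q`. -/
def IsComparisonOnSide {X : Type*} [MetricSpace X] (c : ℝ → X) (p : X) (P Q : Plane)
    (u : X) (U : Plane) : Prop :=
  u ∈ c '' Icc (0 : ℝ) 1 ∧ U ∈ segment ℝ P Q ∧ dist P U = dist p u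

/-- `u` lies on the geodesic triangle with vertices `p, q, r` and sides
`a` (from `p` to `q`), `b` (from `q` to `r`), `c` (from `r` to `p`), and `U` is a comparison
point of `u` in the plane triangle `P, Q, R`. -/
def IsComparisonPoint {X : Type*} [MetricSpace X] (a b c : ℝ → X) (p q r : X) (P Q R : Plane)
    (u : X) (U : Plane) : Prop :=
  IsComparisonOnSide a p P Q u U ∨ IsComparisonOnSide b q Q R u U ∨
    IsComparisonOnSide c r R P u U

/-- CAT(0) spaces: geodesic metric spaces whose geodesic triangles are not thicker than their
Euclidean comparison triangles. -/
class CAT0Space (X : Type*) [MetricSpace X] : Prop where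
  exists_geodesic : ∀ p q : X, ∃ c : ℝ → X, IsGeodesic c p q
  comparison : ∀ (p q r : X) (a b c : ℝ → X),
    IsGeodesic a p q → IsGeodesic b q r → IsGeodesic c r p →
    ∀ P Q R : Plane, IsComparisonTriangle p q r P Q R →
    ∀ (u v : X) (U V : Plane), IsComparisonPoint a b c p q r P Q R u U →
      IsComparisonPoint a b c p q r P Q R v V → dist u v ≤ dist U V

/-- Every (nondegenerate) unit speed geodesic extends to a bi-infinite geodesic line. -/
def GeodesicExtensionProperty (X : Type*) [MetricSpace X] : Prop :=
  ∀ L : ℝ, 0 < L → ∀ c : ℝ → X,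
    (∀ s ∈ Icc (0 : ℝ) L, ∀ t ∈ Icc (0 : ℝ) L, dist (c s) (c t) = |s - t|) →
    ∃ e : ℝ → X, Isometry e ∧ EqOn e c (Icc 0 L)

/-! ### Angles and the space of directions -/

open Classical in
/-- The comparison angle at `p` between `q` and `r`: the angle at the vertex corresponding to `p`
of a Euclidean comparison triangle (computed by the law of cosines), with the conventions `0` if
`q = r = p` and `π / 2` if exactly one of `q`, `r` equals `p`. -/
def compAngle {X : Type*} [MetricSpace X] (p q r : X) : ℝ :=
  if q = p ∧ r = p then 0
  else if q = p ∨ r = p then Real.pi / 2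
  else Real.arccos ((dist p q ^ 2 + dist p r ^ 2 - dist q r ^ 2) / (2 * dist p q * dist p r))

/-- Normalized geodesics issuing from `p`. -/
structure GeodesicFrom {X : Type*} [MetricSpace X] (p : X) where
  toFun : ℝ → X
  isGeodesic : IsGeodesic toFun p (toFun 1)

/-- The zero geodesic at `p`. -/
def GeodesicFrom.zero {X : Type*} [MetricSpace X] (p : X) : GeodesicFrom p where
  toFun := fun _ => p
  isGeodesic := by simp [IsGeodesic]

/-- The Alexandrov angle of two geodesics issuing from `p`. The upper limit is a limit in every
CAT(0) space. -/
def alexandrovAngle {X : Type*} [MetricSpace X] {p : X} (c₁ c₂ : GeodesicFrom p) : ℝ :=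
  limsup (fun st : ℝ × ℝ => compAngle p (c₁.toFun st.1) (c₂.toFun st.2))
    (𝓝[>] (0 : ℝ) ×ˢ 𝓝[>] (0 : ℝ))

/-- The space of directions at `p`: the metric identification of the set of normalized geodesics
issuing from `p` with the pseudometric given by the Alexandrov angle. -/
def Direction {X : Type*} [MetricSpace X] (p : X) : Type _ :=
  Quot (fun c₁ c₂ : GeodesicFrom p => alexandrovAngle c₁ c₂ = 0)

/-- The direction of a geodesic. -/
def Direction.mk {X : Type*} [MetricSpace X] {p : X} (c : GeodesicFrom p) : Direction p :=
  Quot.mk _ c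

/-- The direction of the zero geodesic. -/
def Direction.zero {X : Type*} [MetricSpace X] (p : X) : Direction p :=
  Direction.mk (GeodesicFrom.zero p)

/-- The angle of two directions is the Alexandrov angle of representatives; since the latter is
a pseudometric, the value does not depend on the choice of the representatives. -/
def Direction.angle {X : Type*} [MetricSpace X] {p : X} (σ τ : Direction p) : ℝ :=
  alexandrovAngle (Quot.out σ) (Quot.out τ)

open Classical in
/-- The indicator of nonzero directions. -/
def Direction.ind {X : Type*} [MetricSpace X] {p : X} (σ : Direction p) : ℝ :=
  if σ = Direction.zero p then 0 else 1

/-! ### Tangent spaces -/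

/-- Pairs `(t₁, σ₁)` and `(t₂, σ₂)` represent the same tangent vector if both represent zero, or
if neither does and they are equal. -/
def tangentSetoid {X : Type*} [MetricSpace X] (p : X) : Setoid (ℝ≥0 × Direction p) where
  r v w := ((v.1 : ℝ) * v.2.ind = 0 ∧ (w.1 : ℝ) * w.2.ind = 0) ∨
    ((v.1 : ℝ) * v.2.ind = (w.1 : ℝ) * w.2.ind ∧ 0 < (w.1 : ℝ) * w.2.ind ∧ v.2 = w.2)
  iseqv := by
    refine ⟨fun v => ?_, ?_, ?_⟩
    · rcases eq_or_ne ((v.1 : ℝ) * v.2.ind) 0 with h | h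
      · exact Or.inl ⟨h, h⟩
      · refine Or.inr ⟨rfl, lt_of_le_of_ne (mul_nonneg v.1.2 ?_) h.symm, rfl⟩
        unfold Direction.ind; split_ifs <;> norm_num
    · rintro v w (⟨h, k⟩ | ⟨h, k, l⟩)
      · exact Or.inl ⟨k, h⟩
      · exact Or.inr ⟨h.symm, h ▸ k, l.symm⟩
    · rintro u v w (⟨h, k⟩ | ⟨h, k, l⟩) (⟨h', k'⟩ | ⟨h', k', l'⟩)
      · exact Or.inl ⟨h, k'⟩
      · exact absurd (h'.symm.trans k) k'.ne'
      · exact absurd h' k.ne'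
      · exact Or.inr ⟨h.trans h', k', l.trans l'⟩

/-- The tangent space at `p`. -/
def TangentSpace {X : Type*} [MetricSpace X] (p : X) : Type _ := Quotient (tangentSetoid p)

/-- The tangent vector `t σ`. -/
def TangentSpace.mk {X : Type*} [MetricSpace X] {p : X} (t : ℝ≥0) (σ : Direction p) :
    TangentSpace p :=
  Quotient.mk (tangentSetoid p) (t, σ)

/-- The zero tangent vector at `p`. -/
def TangentSpace.zero {X : Type*} [MetricSpace X] (p : X) : TangentSpace p :=
  TangentSpace.mk 0 (Direction.zero p)

/-- The formula for the tangent metric on representatives. -/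
def tangentDistAux {X : Type*} [MetricSpace X] {p : X} (v w : ℝ≥0 × Direction p) : ℝ :=
  Real.sqrt ((v.1 : ℝ) ^ 2 * v.2.ind + (w.1 : ℝ) ^ 2 * w.2.ind
    - 2 * v.1 * w.1 * v.2.ind * w.2.ind * Real.cos (v.2.angle w.2))

/-- The metric of the tangent space at `p`. -/
def TangentSpace.tdist {X : Type*} [MetricSpace X] {p : X} : TangentSpace p → TangentSpace p → ℝ :=
  Quotient.lift₂ tangentDistAux (by
    have key : ∀ v v' : ℝ≥0 × Direction p, (tangentSetoid p).r v v' →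
        (v.1 : ℝ) ^ 2 * v.2.ind = (v'.1 : ℝ) ^ 2 * v'.2.ind ∧
        ∀ f : Direction p → ℝ, (v.1 : ℝ) * v.2.ind * f v.2 = (v'.1 : ℝ) * v'.2.ind * f v'.2 := by
      rintro ⟨t, σ⟩ ⟨t', σ'⟩ (⟨h, k⟩ | ⟨h, k, l⟩)
      · refine ⟨?_, fun f => by simp only [h, k, zero_mul]⟩
        have e1 : (t : ℝ) ^ 2 * σ.ind = t * (t * σ.ind) := by ring
        have e2 : (t' : ℝ) ^ 2 * σ'.ind = t' * (t' * σ'.ind) := by ring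
        simp only at h k
        change (t : ℝ) ^ 2 * σ.ind = (t' : ℝ) ^ 2 * σ'.ind
        rw [e1, e2, h, k, mul_zero, mul_zero]
      · change σ = σ' at l
        subst l
        have h2 : (t : ℝ) = t' := mul_right_cancel₀ (right_ne_zero_of_mul k.ne') h
        simp [h2]
    intro v w v' w' hv hw
    obtain ⟨hv1, hv2⟩ := key _ _ hv
    obtain ⟨hw1, hw2⟩ := key _ _ hw
    unfold tangentDistAux
    have e1 := hv2 (fun σ => (w.1 : ℝ) * w.2.ind * Real.cos (σ.angle w.2))
    have e2 := hw2 (fun τ => (v'.1 : ℝ) * v'.2.ind * Real.cos (v'.2.angle τ))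
    congr 1
    beta_reduce at e1 e2
    linear_combination hv1 + hw1 - 2 * e1 - 2 * e2)

/-- The norm on the tangent space at `p`. -/
def TangentSpace.tnorm {X : Type*} [MetricSpace X] {p : X} (v : TangentSpace p) : ℝ :=
  TangentSpace.tdist (TangentSpace.zero p) v

/-- The product `g_p` on the tangent space at `p`. -/
def TangentSpace.g {X : Type*} [MetricSpace X] {p : X} (v w : TangentSpace p) : ℝ :=
  1 / 2 * (v.tnorm ^ 2 + w.tnorm ^ 2 - v.tdist w ^ 2)

/-- The (unique) normalized geodesic `γ_{p,q}`, as a geodesic issuing from `p`. -/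
def geod {X : Type*} [MetricSpace X] [CAT0Space X] (p q : X) : GeodesicFrom p where
  toFun := (CAT0Space.exists_geodesic p q).choose
  isGeodesic := by
    have h := (CAT0Space.exists_geodesic p q).choose_spec
    exact ⟨h.1, rfl, by rw [h.2.1]; exact h.2.2⟩

/-- The tangent vector `t γ_{p,q}` at `p`. -/
def vec {X : Type*} [MetricSpace X] [CAT0Space X] (t : ℝ≥0) (p q : X) : TangentSpace p :=
  TangentSpace.mk t (Direction.mk (geod p q))

/-! ### Monotone vector fields, resolvents and the generated semigroup -/

/-- Set-valued vector fields. -/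
abbrev VectorField (X : Type*) [MetricSpace X] := (p : X) → Set (TangentSpace p)

/-- The domain of a vector field. -/
def VectorField.dom {X : Type*} [MetricSpace X] (A : VectorField X) : Set X :=
  {p | (A p).Nonempty}

/-- The set `A⁻¹(0)` of stationary points of a vector field. -/
def VectorField.zeros {X : Type*} [MetricSpace X] (A : VectorField X) : Set X :=
  {p | TangentSpace.zero p ∈ A p}

/-- Monotonicity. -/
def VectorField.IsMonotone {X : Type*} [MetricSpace X] [CAT0Space X] (A : VectorField X) : Prop :=
  ∀ p q : X, ∀ v ∈ A p, ∀ w ∈ A q,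
    TangentSpace.g v (vec 1 p q) ≤ -TangentSpace.g w (vec 1 q p)

/-- The surjectivity condition. -/
def VectorField.Surjectivity {X : Type*} [MetricSpace X] [CAT0Space X] (A : VectorField X) :
    Prop :=
  ∀ t : ℝ≥0, 0 < t → ∀ x : X, ∃ p : X, vec (t * nndist p x) p x ∈ A p

open Classical in
/-- The set-valued resolvent `J_λ` of a vector field, with `J_0` the identity. -/
def VectorField.resolventSet {X : Type*} [MetricSpace X] [CAT0Space X] (A : VectorField X)
    (l : ℝ≥0) (x : X) : Set X :=
  if l = 0 then {x} else {z | vec (l⁻¹ * nndist z x) z x ∈ A z}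

open Classical in
/-- The resolvent as a map: the element of `J_λ x`. (For monotone vector fields with the
surjectivity condition, `J_λ x` is always a singleton.) -/
def VectorField.resolvent {X : Type*} [MetricSpace X] [CAT0Space X] (A : VectorField X)
    (l : ℝ≥0) (x : X) : X :=
  if h : (A.resolventSet l x).Nonempty then h.some else x

/-- The approximations `J_{t/k}^k x`. -/
def VectorField.approx {X : Type*} [MetricSpace X] [CAT0Space X] (A : VectorField X)
    (t : ℝ≥0) (x : X) (k : ℕ) : X :=
  (A.resolvent (t / k))^[k] x

/-- The semigroup generated by `A`: `S(t)x = lim_k J_{t/k}^k x`. -/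
def VectorField.semigroup {X : Type*} [MetricSpace X] [CAT0Space X] (A : VectorField X)
    (t : ℝ≥0) (x : X) : X :=
  haveI : Nonempty X := ⟨x⟩
  limUnder atTop (A.approx t x)

/-! ### Δ-convergence -/

/-- `z` is the asymptotic center of the (bounded) sequence `u`: it minimizes
`y ↦ limsup_k d(y, u_k)`. (In a complete CAT(0) space the minimizer is unique.) -/
def IsAsymptoticCenter {X : Type*} [MetricSpace X] (u : ℕ → X) (z : X) : Prop :=
  ∀ y : X, limsup (fun k => dist z (u k)) atTop ≤ limsup (fun k => dist y (u k)) atTop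

/-- The bounded sequence `u` is Δ-convergent to `z`: `z` is the asymptotic center of every
subsequence. -/
def DeltaConverges {X : Type*} [MetricSpace X] (u : ℕ → X) (z : X) : Prop :=
  Bornology.IsBounded (range u) ∧ ∀ φ : ℕ → ℕ, StrictMono φ → IsAsymptoticCenter (u ∘ φ) z

/-- The curve `f` is Δ-convergent to `z` as `t → ∞`, that is, along every sequence of times
tending to infinity. -/
def DeltaConvergesAtInfinity {X : Type*} [MetricSpace X] (f : ℝ≥0 → X) (z : X) : Prop :=
  ∀ τ : ℕ → ℝ≥0, Tendsto τ atTop atTop → DeltaConverges (f ∘ τ) z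

/-- `z` is a Δ-accumulation point of the curve `f` as `t → ∞`. -/
def IsDeltaAccumulationPoint {X : Type*} [MetricSpace X] (f : ℝ≥0 → X) (z : X) : Prop :=
  ∃ τ : ℕ → ℝ≥0, Tendsto τ atTop atTop ∧ DeltaConverges (f ∘ τ) z

end

end Hadamard

namespace Hadamard

/-! The Alexandrov angle is at most the comparison angle, so the product `g` of a resolvent vector
with a geodesic direction is bounded below by squared distances (`le_dist_mul_g_vec`). Monotonicity
then becomes a purely metric inequality for resolvents (`resolvent_inequality`,
`dist_resolvent_sq_le`), and tangent spaces play no further role.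

From it follow nonexpansiveness of `A.resolvent l`, the decrease of distances to stationary points,
and a Crandall-Liggett estimate with two step sizes (`dist_iterate_iterate_sq_le`). The last makes
`A.approx t x` Cauchy. It also lets S(s)x and S(t)x be computed with a common step size, so the
decrease of distances passes to the trajectory (`antitone_dist_semigroup`), which is therefore
bounded.

What remains is Opial's argument (`exists_deltaConvergesAtInfinity`): bounded sequences have
Δ-convergent subsequences, and along the trajectory the distance to each stationary point has a
limit. Comparing these limits shows that a single accumulation point is an asymptotic center along
every sequence of times. -/

/-! ### Comparison triangles and quadratic distance inequalities. -/

theorem dist_plane_sq (x y x' y' : ℝ) :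
    dist (!₂[x, y] : Plane) !₂[x', y'] ^ 2 = (x - x') ^ 2 + (y - y') ^ 2 := by
  rw [EuclideanSpace.dist_eq, Real.sq_sqrt (by positivity), Fin.sum_univ_two]
  simp [Real.dist_eq]

theorem exists_comparisonTriangle {X : Type*} [MetricSpace X] (p q r : X) :
    ∃ P Q R : Plane, IsComparisonTriangle p q r P Q R := by
  unfold IsComparisonTriangle
  have k1 : dist r p ≤ dist p q + dist q r := by rw [dist_comm]; exact dist_triangle p q r
  have k2 : dist p q ≤ dist q r + dist r p := by
    linarith [dist_triangle q r p, dist_comm p q]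
  have k3 : dist q r ≤ dist r p + dist p q := by
    linarith [dist_triangle q p r, dist_comm r p, dist_comm p q]
  have ha : 0 ≤ dist p q := dist_nonneg
  have hb : 0 ≤ dist q r := dist_nonneg
  have hc : 0 ≤ dist r p := dist_nonneg
  generalize dist p q = a at *
  generalize dist q r = b at *
  generalize dist r p = c at *
  have key : ∀ x y : ℝ, x ^ 2 + y ^ 2 = c ^ 2 → (a - x) ^ 2 + y ^ 2 = b ^ 2 →
      ∃ P Q R : Plane, dist P Q = a ∧ dist Q R = b ∧ dist R P = c := by
    intro x y h1 h2
    refine ⟨!₂[0, 0], !₂[a, 0], !₂[x, y], ?_, ?_, ?_⟩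
    · rw [← sq_eq_sq₀ dist_nonneg ha, dist_plane_sq]; ring
    · rw [← sq_eq_sq₀ dist_nonneg hb, dist_plane_sq, ← h2]; ring
    · rw [← sq_eq_sq₀ dist_nonneg hc, dist_plane_sq, ← h1]; ring
  rcases ha.eq_or_lt with h0 | h0
  · have hbc : b = c := by linarith
    exact key c 0 (by ring) (by rw [← h0, hbc]; ring)
  -- The abscissa of the third vertex comes from the law of cosines; the triangle inequalities make
  -- `c ^ 2 - x ^ 2` nonnegative.
  · set x := (a ^ 2 + c ^ 2 - b ^ 2) / (2 * a) with hx
    have hxa : 2 * a * x = a ^ 2 + c ^ 2 - b ^ 2 := by rw [hx]; field_simp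
    have hy : 0 ≤ c ^ 2 - x ^ 2 := by
      have h4 : 0 ≤ (c - x) := by
        have : 0 ≤ 2 * a * (c - x) := by nlinarith
        exact nonneg_of_mul_nonneg_right this (by positivity)
      have h5 : 0 ≤ (c + x) := by
        have : 0 ≤ 2 * a * (c + x) := by nlinarith
        exact nonneg_of_mul_nonneg_right this (by positivity)
      nlinarith
    refine key x (√(c ^ 2 - x ^ 2)) ?_ ?_ <;> rw [Real.sq_sqrt hy] <;> linarith

theorem dist_sq_smul_sub {V : Type*} [NormedAddCommGroup V] [InnerProductSpace ℝ V]
    (P Q R : V) (l m : ℝ) :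
    dist (P + l • (Q - P)) (P + m • (R - P)) ^ 2 =
      l ^ 2 * dist P Q ^ 2 + m ^ 2 * dist P R ^ 2
        - l * m * (dist P Q ^ 2 + dist P R ^ 2 - dist Q R ^ 2) := by
  have e1 : dist (P + l • (Q - P)) (P + m • (R - P)) = ‖l • (Q - P) - m • (R - P)‖ := by
    rw [dist_eq_norm]; congr 1; abel
  have e2 : dist Q R = ‖(Q - P) - (R - P)‖ := by rw [dist_eq_norm]; congr 1; abel
  rw [e1, e2, dist_comm P Q, dist_comm P R, dist_eq_norm, dist_eq_norm]
  generalize Q - P = u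
  generalize R - P = v
  rw [norm_sub_sq_real, norm_sub_sq_real, norm_smul, norm_smul, mul_pow, mul_pow, Real.norm_eq_abs, Real.norm_eq_abs,
    sq_abs, sq_abs, inner_smul_left, inner_smul_right]
  simp
  ring

theorem IsGeodesic.symm {X : Type*} [MetricSpace X] {c : ℝ → X} {p q : X} (h : IsGeodesic c p q) :
    IsGeodesic (fun t => c (1 - t)) q p := by
  refine ⟨by simp [h.2.1], by simp [h.1], fun s hs t ht => ?_⟩
  rw [h.2.2 (1 - s) ⟨by linarith [hs.2], by linarith [hs.1]⟩ (1 - t)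
    ⟨by linarith [ht.2], by linarith [ht.1]⟩, dist_comm q p, abs_sub_comm s t]
  congr 2; ring

theorem IsGeodesic.dist_left {X : Type*} [MetricSpace X] {c : ℝ → X} {p q : X}
    (h : IsGeodesic c p q) {t : ℝ} (ht : t ∈ Icc (0 : ℝ) 1) : dist p (c t) = t * dist p q := by
  have := h.2.2 0 (by simp) t ht
  rw [h.1] at this
  rw [this, zero_sub, abs_neg, abs_of_nonneg ht.1, mul_comm]

theorem IsGeodesic.comp_mul {X : Type*} [MetricSpace X] {c : ℝ → X} {p q : X}
    (h : IsGeodesic c p q) {l : ℝ} (hl : l ∈ Icc (0 : ℝ) 1) :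
    IsGeodesic (fun t => c (l * t)) p (c l) := by
  have hm : ∀ s ∈ Icc (0 : ℝ) 1, l * s ∈ Icc (0 : ℝ) 1 := fun s hs =>
    ⟨mul_nonneg hl.1 hs.1, mul_le_one₀ hl.2 hs.1 hs.2⟩
  refine ⟨by simp [h.1], by simp, fun s hs t ht => ?_⟩
  rw [h.2.2 _ (hm s hs) _ (hm t ht), h.dist_left hl, ← mul_sub, abs_mul, abs_of_nonneg hl.1]
  ring

section
variable {X : Type*} [MetricSpace X] [CAT0Space X]

/-- Comparison of two points on the sides of a geodesic hinge. -/
theorem dist_sq_le_of_isGeodesic {p q r : X} {a c : ℝ → X} (ha : IsGeodesic a p q)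
    (hc : IsGeodesic c p r) {l m : ℝ} (hl : l ∈ Icc (0 : ℝ) 1) (hm : m ∈ Icc (0 : ℝ) 1) :
    dist (a l) (c m) ^ 2 ≤ l ^ 2 * dist p q ^ 2 + m ^ 2 * dist p r ^ 2
        - l * m * (dist p q ^ 2 + dist p r ^ 2 - dist q r ^ 2) := by
  obtain ⟨b, hb⟩ := CAT0Space.exists_geodesic q r
  obtain ⟨P, Q, R, hPQR⟩ := exists_comparisonTriangle p q r
  have hPQ : dist P Q = dist p q := hPQR.1
  have hQR : dist Q R = dist q r := hPQR.2.1
  have hRP : dist P R = dist p r := by rw [dist_comm, hPQR.2.2, dist_comm]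
  have hd : ∀ (S : Plane) (s : ℝ), 0 ≤ s → dist P (P + s • (S - P)) = s * dist P S := by
    intro S s hs
    rw [dist_self_add_right, norm_smul, Real.norm_of_nonneg hs, dist_comm, dist_eq_norm]
  have key := CAT0Space.comparison p q r a b _ ha hb hc.symm P Q R hPQR (a l) (c m)
    (P + l • (Q - P)) (P + m • (R - P)) (Or.inl ⟨⟨l, hl, rfl⟩, ?_, ?_⟩)
    -- The third side of the triangle runs from `r` to `p`, so `c m` is reached on it at time `1 -
    -- m`.
    (Or.inr (Or.inr ⟨⟨1 - m, ⟨by linarith [hm.2], by linarith [hm.1]⟩, by simp⟩, ?_, ?_⟩))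
  · rw [← hPQ, ← hQR, ← hRP, ← dist_sq_smul_sub]
    exact pow_le_pow_left₀ dist_nonneg key 2
  · rw [segment_eq_image']; exact ⟨l, hl, rfl⟩
  · rw [hd _ _ hl.1, hPQ, ha.dist_left hl]
  · rw [segment_symm, segment_eq_image']; exact ⟨m, hm, rfl⟩
  · have h1 : dist R (P + m • (R - P)) = (1 - m) * dist P R := by
      have : R - (P + m • (R - P)) = (1 - m) • (R - P) := by module
      rw [dist_eq_norm, this, norm_smul, Real.norm_of_nonneg (by linarith [hm.2]), dist_comm,
        dist_eq_norm]
    have h2 := hc.symm.dist_left (t := 1 - m) ⟨by linarith [hm.2], by linarith [hm.1]⟩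
    simp only [sub_sub_cancel] at h2
    rw [h1, h2, hRP, dist_comm p r]

/-- The Bruhat-Tits inequality. -/
theorem exists_midpoint_dist_sq_le (p q : X) : ∃ m : X, ∀ y : X,
    dist y m ^ 2 ≤ dist y p ^ 2 / 2 + dist y q ^ 2 / 2 - dist p q ^ 2 / 4 := by
  obtain ⟨a, ha⟩ := CAT0Space.exists_geodesic p q
  refine ⟨a 2⁻¹, fun y => ?_⟩
  obtain ⟨c, hc⟩ := CAT0Space.exists_geodesic p y
  have h := dist_sq_le_of_isGeodesic ha hc (l := 2⁻¹) (m := 1) (by norm_num) (by norm_num)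
  rw [hc.2.1] at h
  rw [dist_comm y, dist_comm y, dist_comm y]
  linarith

/-- Apply Bruhat-Tits at the midpoint of `p` and `r`, seen from `q` and from `s`, and use `(a + b) ^
2 ≤ 2 * (a ^ 2 + b ^ 2)` for the path from `q` to `s` through it. This is what yields nonexpansive
resolvents. -/
theorem dist_sq_add_dist_sq_le (p q r s : X) :
    dist p r ^ 2 + dist q s ^ 2 ≤
      dist p q ^ 2 + dist q r ^ 2 + dist r s ^ 2 + dist s p ^ 2 := by
  obtain ⟨m, hm⟩ := exists_midpoint_dist_sq_le p r
  have h1 := hm q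
  have h2 := hm s
  have h3 := dist_triangle_right q s m
  rw [dist_comm q p] at h1
  rw [dist_comm s r] at h2
  have h4 : dist q s ^ 2 ≤ (dist q m + dist s m) ^ 2 := pow_le_pow_left₀ dist_nonneg h3 2
  nlinarith [sq_nonneg (dist q m - dist s m)]
end

/-! ### Comparison angles and Alexandrov angles. -/

section
variable {X : Type*} [MetricSpace X]

theorem compAngle_comm (p q r : X) : compAngle p q r = compAngle p r q := by
  unfold compAngle
  rw [dist_comm q r, mul_right_comm, add_comm (dist p q ^ 2)]
  split_ifs <;> tauto

theorem compAngle_congr {p q r q' r' : X} (hq : q = p ↔ q' = p) (hr : r = p ↔ r' = p)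
    (h : q = p ∨ r = p) : compAngle p q r = compAngle p q' r' := by
  unfold compAngle
  split_ifs <;> tauto

theorem compAngle_nonneg (p q r : X) : 0 ≤ compAngle p q r := by
  unfold compAngle
  split_ifs
  · rfl
  · positivity
  · exact Real.arccos_nonneg _

theorem compAngle_le_pi (p q r : X) : compAngle p q r ≤ Real.pi := by
  unfold compAngle
  split_ifs
  · positivity
  · linarith [Real.pi_pos]
  · exact Real.arccos_le_pi _

theorem compAngle_self (p q : X) : compAngle p q q = 0 := by
  unfold compAngle
  split_ifs with h h'
  · rfl
  · simp_all
  · have hq : dist p q ≠ 0 := fun h0 => h' (Or.inl (dist_eq_zero.1 h0).symm)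
    rw [Real.arccos_eq_zero, dist_self]
    apply le_of_eq
    field_simp
    ring

theorem compAngle_of_ne {p q r : X} (hq : q ≠ p) (hr : r ≠ p) :
    compAngle p q r =
      Real.arccos ((dist p q ^ 2 + dist p r ^ 2 - dist q r ^ 2) / (2 * dist p q * dist p r)) := by
  simp [compAngle, hq, hr]

theorem cos_compAngle {p q r : X} (hq : q ≠ p) (hr : r ≠ p) :
    2 * dist p q * dist p r * Real.cos (compAngle p q r) =
      dist p q ^ 2 + dist p r ^ 2 - dist q r ^ 2 := by
  have h1 : 0 < dist p q := dist_pos.2 hq.symm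
  have h2 : 0 < dist p r := dist_pos.2 hr.symm
  have k1 := dist_triangle p q r
  have k2 : dist p q ≤ dist p r + dist q r := by linarith [dist_triangle p r q, dist_comm q r]
  have k3 : dist q r ≤ dist p q + dist p r := dist_triangle_left q r p
  rw [compAngle_of_ne hq hr, Real.cos_arccos]
  · field_simp
  · rw [le_div_iff₀ (by positivity)]
    nlinarith [dist_nonneg (x := q) (y := r)]
  · rw [div_le_iff₀ (by positivity)]
    nlinarith [dist_nonneg (x := q) (y := r)]

namespace GeodesicFrom
variable {p : X}

theorem dist_left (c : GeodesicFrom p) {t : ℝ} (ht : t ∈ Icc (0 : ℝ) 1) :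
    dist p (c.toFun t) = t * dist p (c.toFun 1) :=
  c.isGeodesic.dist_left ht

theorem apply_eq (c : GeodesicFrom p) {t : ℝ} (ht : t ∈ Ioc (0 : ℝ) 1) :
    c.toFun t = p ↔ c.toFun 1 = p := by
  rw [eq_comm, ← dist_eq_zero, c.dist_left ⟨ht.1.le, ht.2⟩, mul_eq_zero, or_iff_right ht.1.ne',
    dist_eq_zero, eq_comm]

end GeodesicFrom
end

section
variable {X : Type*} [MetricSpace X] [CAT0Space X] {p : X}

/-- Hinge comparison on the geodesics cut off at `s'` and `t'`, with ratios `s / s'` and `t / t'`.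
Degenerate cases hold because the conventional values depend only on which endpoints equal `p`. -/
theorem compAngle_mono (c d : GeodesicFrom p) {s s' t t' : ℝ} (hs : 0 < s) (hs' : s ≤ s')
    (h1 : s' ≤ 1) (ht : 0 < t) (ht' : t ≤ t') (h2 : t' ≤ 1) :
    compAngle p (c.toFun s) (d.toFun t) ≤ compAngle p (c.toFun s') (d.toFun t') := by
  have hs0 := hs.trans_le hs'
  have ht0 := ht.trans_le ht'
  have e1 := c.apply_eq (t := s) ⟨hs, hs'.trans h1⟩
  have e2 := c.apply_eq (t := s') ⟨hs0, h1⟩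
  have e3 := d.apply_eq (t := t) ⟨ht, ht'.trans h2⟩
  have e4 := d.apply_eq (t := t') ⟨ht0, h2⟩
  by_cases hc : c.toFun 1 = p
  · exact (compAngle_congr (e1.trans e2.symm) (e3.trans e4.symm) (Or.inl (e1.2 hc))).le
  by_cases hd : d.toFun 1 = p
  · exact (compAngle_congr (e1.trans e2.symm) (e3.trans e4.symm) (Or.inr (e3.2 hd))).le
  have hcp : 0 < dist p (c.toFun 1) := dist_pos.2 (Ne.symm hc)
  have hdp : 0 < dist p (d.toFun 1) := dist_pos.2 (Ne.symm hd)
  rw [compAngle_of_ne (by rwa [Ne, e1]) (by rwa [Ne, e3]),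
    compAngle_of_ne (by rwa [Ne, e2]) (by rwa [Ne, e4])]
  apply Real.arccos_le_arccos
  have key := dist_sq_le_of_isGeodesic
    (c.isGeodesic.comp_mul (l := s') ⟨hs0.le, h1⟩) (d.isGeodesic.comp_mul (l := t') ⟨ht0.le, h2⟩)
    (l := s / s') (m := t / t') ⟨by positivity, (div_le_one hs0).2 hs'⟩
    ⟨by positivity, (div_le_one ht0).2 ht'⟩
  simp only [mul_div_cancel₀ _ hs0.ne', mul_div_cancel₀ _ ht0.ne'] at key
  rw [c.dist_left (t := s) ⟨hs.le, hs'.trans h1⟩, c.dist_left (t := s') ⟨hs0.le, h1⟩,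
    d.dist_left (t := t) ⟨ht.le, ht'.trans h2⟩, d.dist_left (t := t') ⟨ht0.le, h2⟩] at *
  generalize dist p (c.toFun 1) = a at *
  generalize dist p (d.toFun 1) = b at *
  rw [div_le_div_iff₀ (by positivity) (by positivity)]
  generalize dist (c.toFun s') (d.toFun t') = D at *
  generalize dist (c.toFun s) (d.toFun t) = E at *
  have k2 : (s' * t') * E ^ 2 ≤ (s' * t') * ((s / s') ^ 2 * (s' * a) ^ 2
      + (t / t') ^ 2 * (t' * b) ^ 2 - s / s' * (t / t') * ((s' * a) ^ 2 + (t' * b) ^ 2 - D ^ 2)) := by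
    gcongr
  have k3 : (s' * t') * ((s / s') ^ 2 * (s' * a) ^ 2
      + (t / t') ^ 2 * (t' * b) ^ 2 - s / s' * (t / t') * ((s' * a) ^ 2 + (t' * b) ^ 2 - D ^ 2))
      = (s' * t') * (s ^ 2 * a ^ 2 + t ^ 2 * b ^ 2)
        - s * t * ((s' * a) ^ 2 + (t' * b) ^ 2 - D ^ 2) := by
    field_simp
  rw [k3] at k2
  have k4 := mul_le_mul_of_nonneg_left k2 (by positivity : 0 ≤ 2 * a * b)
  linarith

/-- By monotonicity the limit is the infimum of the comparison angles over the unit square, and the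
value at `(1, 1)` is one of them. -/
theorem tendsto_alexandrovAngle (c d : GeodesicFrom p) :
    Tendsto (fun st : ℝ × ℝ => compAngle p (c.toFun st.1) (d.toFun st.2))
      (𝓝[>] (0 : ℝ) ×ˢ 𝓝[>] (0 : ℝ)) (𝓝 (alexandrovAngle c d)) ∧
    alexandrovAngle c d ≤ compAngle p (c.toFun 1) (d.toFun 1) := by
  set h := fun st : ℝ × ℝ => compAngle p (c.toFun st.1) (d.toFun st.2) with hh
  set S := h '' (Ioc 0 1 ×ˢ Ioc 0 1) with hS
  have hbdd : BddBelow S := ⟨0, by rintro _ ⟨st, -, rfl⟩; exact compAngle_nonneg _ _ _⟩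
  have hmem : h (1, 1) ∈ S := ⟨(1, 1), by simp, rfl⟩
  have ht : Tendsto h (𝓝[>] (0 : ℝ) ×ˢ 𝓝[>] (0 : ℝ)) (𝓝 (sInf S)) := by
    have hev : ∀ a : ℝ, 0 < a → ∀ᶠ s in 𝓝[>] (0 : ℝ), s ∈ Ioc 0 a := fun a ha =>
      Ioc_mem_nhdsGT ha
    refine tendsto_order.2 ⟨fun a ha => ?_, fun a ha => ?_⟩
    · filter_upwards [(hev 1 one_pos).prod_mk (hev 1 one_pos)] with st hst
      exact ha.trans_le (csInf_le hbdd ⟨st, hst, rfl⟩)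
    · obtain ⟨_, ⟨st, hst, rfl⟩, hlt⟩ := exists_lt_of_csInf_lt ⟨_, hmem⟩ ha
      filter_upwards [(hev _ hst.1.1).prod_mk (hev _ hst.2.1)] with uv huv
      exact (compAngle_mono c d huv.1.1 huv.1.2 hst.1.2 huv.2.1 huv.2.2 hst.2.2).trans_lt hlt
  have he : alexandrovAngle c d = sInf S := ht.limsup_eq
  exact ⟨he ▸ ht, he ▸ csInf_le hbdd hmem⟩

theorem alexandrovAngle_le (c d : GeodesicFrom p) :
    alexandrovAngle c d ≤ compAngle p (c.toFun 1) (d.toFun 1) :=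
  (tendsto_alexandrovAngle c d).2

theorem alexandrovAngle_nonneg (c d : GeodesicFrom p) : 0 ≤ alexandrovAngle c d :=
  ge_of_tendsto' (tendsto_alexandrovAngle c d).1 fun _ => compAngle_nonneg _ _ _

theorem alexandrovAngle_le_pi (c d : GeodesicFrom p) : alexandrovAngle c d ≤ Real.pi :=
  (alexandrovAngle_le c d).trans (compAngle_le_pi _ _ _)

theorem alexandrovAngle_comm (c d : GeodesicFrom p) :
    alexandrovAngle c d = alexandrovAngle d c := by
  have h := (tendsto_alexandrovAngle d c).1.comp
    (tendsto_snd (f := 𝓝[>] (0 : ℝ)) (g := 𝓝[>] (0 : ℝ)) |>.prodMk tendsto_fst)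
  refine tendsto_nhds_unique (tendsto_alexandrovAngle c d).1 (h.congr fun st => ?_)
  exact compAngle_comm _ _ _

theorem alexandrovAngle_self_of_eq {c d : GeodesicFrom p} (h : c.toFun 1 = d.toFun 1) :
    alexandrovAngle c d = 0 := by
  refine le_antisymm ?_ (alexandrovAngle_nonneg c d)
  simpa [h, compAngle_self] using alexandrovAngle_le c d

theorem alexandrovAngle_eq_of_zero {c : GeodesicFrom p} (d : GeodesicFrom p)
    (h : c.toFun 1 = p) :
    alexandrovAngle c d = compAngle p p (d.toFun 1) := by
  refine tendsto_nhds_unique (tendsto_alexandrovAngle c d).1 (tendsto_const_nhds.congr' ?_)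
  have hev : ∀ᶠ s in 𝓝[>] (0 : ℝ), s ∈ Ioc (0 : ℝ) 1 := Ioc_mem_nhdsGT one_pos
  filter_upwards [hev.prod_mk hev] with st hst
  exact compAngle_congr (by simp [c.apply_eq hst.1, h]) (d.apply_eq hst.2).symm (Or.inl rfl)

/-- First variation along equal speed reparametrizations of two nonzero geodesics. -/
theorem tendsto_dist_div (c d : GeodesicFrom p) (hc : c.toFun 1 ≠ p) (hd : d.toFun 1 ≠ p) :
    Tendsto (fun e : ℝ => dist (c.toFun (e / dist p (c.toFun 1)))
      (d.toFun (e / dist p (d.toFun 1))) / e) (𝓝[>] 0)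
      (𝓝 √(2 - 2 * Real.cos (alexandrovAngle c d))) := by
  have hcp : 0 < dist p (c.toFun 1) := dist_pos.2 (Ne.symm hc)
  have hdp : 0 < dist p (d.toFun 1) := dist_pos.2 (Ne.symm hd)
  have hdiv : ∀ a : ℝ, 0 < a → Tendsto (fun e : ℝ => e / a) (𝓝[>] 0) (𝓝[>] 0) := by
    intro a ha
    refine tendsto_nhdsWithin_iff.2 ⟨?_, ?_⟩
    · have : Tendsto (fun e : ℝ => e / a) (𝓝 0) (𝓝 (0 / a)) := tendsto_id.div_const a
      rw [zero_div] at this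
      exact this.mono_left nhdsWithin_le_nhds
    · filter_upwards [self_mem_nhdsWithin] with e he
      exact div_pos he ha
  have h1 := (tendsto_alexandrovAngle c d).1.comp ((hdiv _ hcp).prodMk (hdiv _ hdp))
  have h2 := ((Real.continuous_cos.tendsto _).comp h1).const_mul 2 |>.const_sub 2 |>.sqrt
  refine h2.congr' ?_
  have hev : ∀ a : ℝ, 0 < a → ∀ᶠ e in 𝓝[>] (0 : ℝ), e ∈ Ioc 0 a := fun a ha =>
    Ioc_mem_nhdsGT ha
  filter_upwards [hev _ hcp, hev _ hdp] with e he1 he2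
  have he : 0 < e := he1.1
  have m1 : e / dist p (c.toFun 1) ∈ Ioc (0 : ℝ) 1 := ⟨by positivity, (div_le_one hcp).2 he1.2⟩
  have m2 : e / dist p (d.toFun 1) ∈ Ioc (0 : ℝ) 1 := ⟨by positivity, (div_le_one hdp).2 he2.2⟩
  have k := cos_compAngle (by rwa [Ne, c.apply_eq m1]) (by rwa [Ne, d.apply_eq m2])
  rw [c.dist_left ⟨m1.1.le, m1.2⟩, d.dist_left ⟨m2.1.le, m2.2⟩, div_mul_cancel₀ _ hcp.ne',
    div_mul_cancel₀ _ hdp.ne'] at k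
  simp only [Function.comp_apply]
  rw [← Real.sqrt_sq (div_nonneg dist_nonneg he.le), div_pow]
  congr 1
  field_simp
  linarith

/-- Zero angle means that `c` and `c'`, run at unit speed, are `o(e)` apart at time `e`. The chords
to `d` then have the same first-order growth, which determines the angle. This replaces the triangle
inequality for angles. -/
theorem alexandrovAngle_congr_left {c c' : GeodesicFrom p} (h : alexandrovAngle c c' = 0)
    (d : GeodesicFrom p) : alexandrovAngle c d = alexandrovAngle c' d := by
  have hz : c.toFun 1 = p ↔ c'.toFun 1 = p := by
    constructor <;> intro h'
    · by_contra hne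
      rw [alexandrovAngle_eq_of_zero _ h'] at h
      simp [compAngle, hne, Real.pi_ne_zero] at h
    · by_contra hne
      rw [alexandrovAngle_comm, alexandrovAngle_eq_of_zero _ h'] at h
      simp [compAngle, hne, Real.pi_ne_zero] at h
  by_cases hc : c.toFun 1 = p
  · rw [alexandrovAngle_eq_of_zero _ hc, alexandrovAngle_eq_of_zero _ (hz.1 hc)]
  have hc' := mt hz.2 hc
  by_cases hd : d.toFun 1 = p
  · rw [alexandrovAngle_comm, alexandrovAngle_comm c', alexandrovAngle_eq_of_zero _ hd,
      alexandrovAngle_eq_of_zero _ hd]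
    simp [compAngle, hc, hc']
  have t1 := tendsto_dist_div c d hc hd
  have t2 := tendsto_dist_div c' d hc' hd
  have t3 := tendsto_dist_div c c' hc hc'
  rw [h] at t3
  simp only [Real.cos_zero, mul_one, sub_self, Real.sqrt_zero] at t3
  have t4 := t1.sub t2
  have t5 : √(2 - 2 * Real.cos (alexandrovAngle c d))
      - √(2 - 2 * Real.cos (alexandrovAngle c' d)) = 0 := by
    refine tendsto_nhds_unique t4 (squeeze_zero_norm' ?_ t3)
    filter_upwards [self_mem_nhdsWithin] with e he
    rw [← sub_div, norm_div, Real.norm_eq_abs, Real.norm_of_nonneg (le_of_lt he)]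
    exact div_le_div_of_nonneg_right (abs_dist_sub_le _ _ _) (le_of_lt he)
  have hcos : ∀ a : ℝ, 0 ≤ 2 - 2 * Real.cos a := fun a => by linarith [Real.cos_le_one a]
  rw [sub_eq_zero, Real.sqrt_inj (hcos _) (hcos _)] at t5
  exact Real.injOn_cos ⟨alexandrovAngle_nonneg _ _, alexandrovAngle_le_pi _ _⟩
    ⟨alexandrovAngle_nonneg _ _, alexandrovAngle_le_pi _ _⟩ (by linarith)

/-! ### Directions and the product on tangent spaces. -/

theorem Direction.angle_mk (c d : GeodesicFrom p) :
    (Direction.mk c).angle (Direction.mk d) = alexandrovAngle c d := by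
  have key : ∀ c d : GeodesicFrom p,
      alexandrovAngle (Quot.out (Direction.mk c)) d = alexandrovAngle c d := by
    intro c d
    have h := congrArg (Quot.lift (fun c => alexandrovAngle c d)
      fun _ _ h => alexandrovAngle_congr_left h d) (Quot.out_eq (Direction.mk c))
    exact h
  rw [Direction.angle, key, alexandrovAngle_comm, key, alexandrovAngle_comm]

open Classical in
theorem Direction.ind_mk (c : GeodesicFrom p) :
    (Direction.mk c).ind = if c.toFun 1 = p then 0 else 1 := by
  have key : Direction.mk c = Direction.zero p ↔ c.toFun 1 = p := by
    constructor
    -- The angle to the zero geodesic separates the two classes: it is `π / 2` for a nonzero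
    -- geodesic and `0` for a zero one.
    · intro h
      have h2 := congrArg (Quot.lift (fun c => alexandrovAngle c (GeodesicFrom.zero p))
        fun _ _ h => alexandrovAngle_congr_left h _) h
      change alexandrovAngle c (GeodesicFrom.zero p)
        = alexandrovAngle (GeodesicFrom.zero p) (GeodesicFrom.zero p) at h2
      rw [alexandrovAngle_self_of_eq rfl, alexandrovAngle_comm,
        alexandrovAngle_eq_of_zero _ (by rfl)] at h2
      by_contra hne
      simp [compAngle, hne, Real.pi_ne_zero] at h2
    · exact fun h => Quot.sound (alexandrovAngle_self_of_eq h)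
  rw [Direction.ind]
  simp only [key]

theorem geod_one (p q : X) : (geod p q).toFun 1 = q :=
  (CAT0Space.exists_geodesic p q).choose_spec.2.1

omit [CAT0Space X] in
theorem TangentSpace.g_mk (s t : ℝ≥0) (σ τ : Direction p) :
    (TangentSpace.mk s σ).g (TangentSpace.mk t τ) =
      s * t * σ.ind * τ.ind * Real.cos (σ.angle τ) := by
  have hi : ∀ σ : Direction p, σ.ind = 0 ∨ σ.ind = 1 := by
    intro σ; unfold Direction.ind; split_ifs <;> simp
  have hn : ∀ (s : ℝ≥0) (σ : Direction p), (TangentSpace.mk s σ).tnorm ^ 2 = s ^ 2 * σ.ind := by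
    intro s σ
    change tangentDistAux _ _ ^ 2 = _
    rw [tangentDistAux, Real.sq_sqrt]
    · simp
    · rcases hi σ with h | h <;> simp [h]
  have hd : (TangentSpace.mk s σ).tdist (TangentSpace.mk t τ) ^ 2 =
      (s : ℝ) ^ 2 * σ.ind + (t : ℝ) ^ 2 * τ.ind
        - 2 * s * t * σ.ind * τ.ind * Real.cos (σ.angle τ) := by
    change tangentDistAux _ _ ^ 2 = _
    rw [tangentDistAux, Real.sq_sqrt]
    rcases hi σ with h | h <;> rcases hi τ with h' | h' <;> simp only [h, h']
    · simp
    · simp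
    · simp
    · have h0 : (0 : ℝ) ≤ s * t := by positivity
      nlinarith [sq_nonneg ((s : ℝ) - t), Real.cos_le_one (σ.angle τ)]
  rw [TangentSpace.g, hn, hn, hd]
  ring

theorem TangentSpace.g_zero (p q : X) : (TangentSpace.zero p).g (vec 1 p q) = 0 := by
  rw [TangentSpace.zero, vec, TangentSpace.g_mk]
  simp

/-- With the comparison angle in place of the Alexandrov angle this is an equality, the law of
cosines; the Alexandrov angle is smaller and so has the larger cosine. -/
theorem le_dist_mul_g_vec (s : ℝ≥0) (p x q : X) :
    s * (dist p x ^ 2 + dist p q ^ 2 - dist x q ^ 2) ≤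
      2 * dist p q * (vec (s * nndist p x) p x).g (vec 1 p q) := by
  rw [vec, vec, TangentSpace.g_mk, Direction.ind_mk, Direction.ind_mk, Direction.angle_mk,
    geod_one, geod_one]
  by_cases hx : x = p
  · simp [hx]
  by_cases hq : q = p
  · simp [hq, dist_comm]
  have h1 := alexandrovAngle_le (geod p x) (geod p q)
  rw [geod_one, geod_one] at h1
  have h2 := Real.cos_le_cos_of_nonneg_of_le_pi (alexandrovAngle_nonneg _ _)
    (compAngle_le_pi _ _ _) h1
  rw [← cos_compAngle hx hq]
  simp only [hx, hq, if_false, NNReal.coe_mul, coe_nndist, NNReal.coe_one, mul_one]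
  have h3 : 0 ≤ s * (2 * dist p x * dist p q) := by positivity
  nlinarith [mul_le_mul_of_nonneg_left h2 h3]

theorem exists_neg_le_g_vec (v : TangentSpace p) : ∃ C : ℝ≥0, ∀ q : X, -C ≤ v.g (vec 1 p q) := by
  obtain ⟨⟨t, σ⟩, rfl⟩ := Quotient.exists_rep v
  refine ⟨t, fun q => ?_⟩
  change _ ≤ (TangentSpace.mk t σ).g _
  have hi : ∀ σ : Direction p, σ.ind = 0 ∨ σ.ind = 1 := by
    intro σ; unfold Direction.ind; split_ifs <;> simp
  rw [vec, TangentSpace.g_mk]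
  have ht : (0 : ℝ) ≤ t := t.2
  rcases hi σ with h | h <;> rcases hi (Direction.mk (geod p q)) with h' | h' <;>
    simp only [h, h'] <;> simp
  nlinarith [Real.neg_one_le_cos (σ.angle (Direction.mk (geod p q)))]
end
-- Metric inequalities for resolvents.
namespace VectorField
section
variable {X : Type*} [MetricSpace X] [CAT0Space X] {A : VectorField X}

theorem resolvent_zero (x : X) : A.resolvent 0 x = x := by
  unfold resolvent
  split_ifs with h
  · simpa [resolventSet] using h.some_mem
  · rfl

theorem vec_resolvent_mem (hsurj : A.Surjectivity) {l : ℝ≥0} (hl : l ≠ 0) (x : X) :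
    vec (l⁻¹ * nndist (A.resolvent l x) x) (A.resolvent l x) x ∈ A (A.resolvent l x) := by
  have h : (A.resolventSet l x).Nonempty := by
    obtain ⟨p, hp⟩ := hsurj l⁻¹ (by positivity) x
    exact ⟨p, by simpa [resolventSet, hl] using hp⟩
  have h2 : A.resolvent l x ∈ A.resolventSet l x := by
    rw [resolvent, dif_pos h]
    exact h.some_mem
  simpa [resolventSet, hl] using h2

/-- The variational inequality for the resolvent against an arbitrary vector of the field. -/
theorem resolvent_inequality (hmono : A.IsMonotone) (hsurj : A.Surjectivity) (l : ℝ≥0) (x : X)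
    {q : X} {w : TangentSpace q} (hw : w ∈ A q) :
    dist (A.resolvent l x) x ^ 2 + dist (A.resolvent l x) q ^ 2 - dist x q ^ 2 ≤
      l * (2 * dist (A.resolvent l x) q * -(w.g (vec 1 q (A.resolvent l x)))) := by
  rcases eq_or_ne l 0 with rfl | hl
  · simp [resolvent_zero]
  have h1 := hmono _ _ _ (vec_resolvent_mem hsurj hl x) _ hw
  have h2 := le_dist_mul_g_vec l⁻¹ (A.resolvent l x) x q
  have h3 := mul_le_mul_of_nonneg_left h1 (by positivity : 0 ≤ 2 * dist (A.resolvent l x) q)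
  have hl' : (0 : ℝ) < l := by positivity
  have h4 := mul_le_mul_of_nonneg_left (h2.trans h3) hl'.le
  rw [NNReal.coe_inv, mul_inv_cancel_left₀ hl'.ne'] at h4
  exact h4

/-- Take the resolvent vector at `A.resolvent m y` as the competitor in `resolvent_inequality`,
bound its product below by distances, and add with weights `m` and `l`: the products cancel. -/
theorem dist_resolvent_sq_le (hmono : A.IsMonotone) (hsurj : A.Surjectivity) (l m : ℝ≥0)
    (x y : X) :
    (l + m) * dist (A.resolvent l x) (A.resolvent m y) ^ 2
      + m * dist (A.resolvent l x) x ^ 2 + l * dist (A.resolvent m y) y ^ 2 ≤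
      m * dist x (A.resolvent m y) ^ 2 + l * dist (A.resolvent l x) y ^ 2 := by
  rcases eq_or_ne m 0 with rfl | hm
  · simp [resolvent_zero]
  have h1 := resolvent_inequality hmono hsurj l x (vec_resolvent_mem hsurj hm y)
  have h2 := le_dist_mul_g_vec m⁻¹ (A.resolvent m y) y (A.resolvent l x)
  have hm' : (0 : ℝ) < m := by positivity
  have h3 := mul_le_mul_of_nonneg_left h2 (by positivity : (0 : ℝ) ≤ l * m)
  have h4 := mul_le_mul_of_nonneg_left h1 hm'.le
  have h5 : (l : ℝ) * m * (↑m⁻¹ * (dist (A.resolvent m y) y ^ 2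
      + dist (A.resolvent m y) (A.resolvent l x) ^ 2 - dist y (A.resolvent l x) ^ 2)) =
      l * (dist (A.resolvent m y) y ^ 2
      + dist (A.resolvent m y) (A.resolvent l x) ^ 2 - dist y (A.resolvent l x) ^ 2) := by
    rw [NNReal.coe_inv]; field_simp
  rw [h5] at h3
  rw [dist_comm (A.resolvent m y) (A.resolvent l x), dist_comm y (A.resolvent l x)] at h3
  linarith

theorem dist_resolvent_le (hmono : A.IsMonotone) (hsurj : A.Surjectivity) (l : ℝ≥0) (x y : X) :
    dist (A.resolvent l x) (A.resolvent l y) ≤ dist x y := by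
  rcases eq_or_ne l 0 with rfl | hl
  · simp [resolvent_zero]
  have hl' : (0 : ℝ) < l := by positivity
  have h1 := dist_resolvent_sq_le hmono hsurj l l x y
  have h2 := dist_sq_add_dist_sq_le x (A.resolvent l x) (A.resolvent l y) y
  rw [dist_comm y x, dist_comm x (A.resolvent l x)] at h2
  have h3 : (l : ℝ) * dist (A.resolvent l x) (A.resolvent l y) ^ 2 ≤ l * dist x y ^ 2 := by
    nlinarith [mul_le_mul_of_nonneg_left h2 hl'.le]
  exact (sq_le_sq₀ dist_nonneg dist_nonneg).1 (le_of_mul_le_mul_left h3 hl')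

theorem dist_iterate_resolvent_le (hmono : A.IsMonotone) (hsurj : A.Surjectivity) (l : ℝ≥0)
    (n : ℕ) (x y : X) :
    dist ((A.resolvent l)^[n] x) ((A.resolvent l)^[n] y) ≤ dist x y := by
  induction n with
  | zero => rfl
  | succ n ih =>
    rw [Function.iterate_succ_apply', Function.iterate_succ_apply']
    exact (dist_resolvent_le hmono hsurj l _ _).trans ih

theorem dist_resolvent_zeros_le (hmono : A.IsMonotone) (hsurj : A.Surjectivity) (l : ℝ≥0)
    (x : X) {q : X} (hq : q ∈ A.zeros) : dist (A.resolvent l x) q ≤ dist x q := by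
  have h := resolvent_inequality hmono hsurj l x hq
  rw [TangentSpace.g_zero, neg_zero, mul_zero, mul_zero] at h
  exact (sq_le_sq₀ dist_nonneg dist_nonneg).1
    (by linarith [sq_nonneg (dist (A.resolvent l x) x)])

theorem antitone_dist_iterate_resolvent (hmono : A.IsMonotone) (hsurj : A.Surjectivity)
    (l : ℝ≥0) (x : X) {q : X} (hq : q ∈ A.zeros) :
    Antitone fun n => dist ((A.resolvent l)^[n] x) q := by
  refine antitone_nat_of_succ_le fun n => ?_
  rw [Function.iterate_succ_apply']
  exact dist_resolvent_zeros_le hmono hsurj l _ hq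

/-- A tangent vector has product bounded below against all unit directions, so testing with a vector
at `x` itself gives displacement linear in the step, with a constant independent of `l`. -/
theorem exists_dist_resolvent_self_le (hmono : A.IsMonotone) (hsurj : A.Surjectivity) {x : X}
    (hx : x ∈ A.dom) : ∃ C : ℝ≥0, ∀ l : ℝ≥0, dist (A.resolvent l x) x ≤ l * C := by
  obtain ⟨w, hw⟩ := hx
  obtain ⟨C, hC⟩ := exists_neg_le_g_vec w
  refine ⟨C, fun l => ?_⟩
  have h := resolvent_inequality hmono hsurj l x hw
  rw [dist_self] at h
  have h1 := hC (A.resolvent l x)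
  rcases (dist_nonneg (x := A.resolvent l x) (y := x)).eq_or_lt with h0 | h0
  · rw [← h0]; positivity
  · generalize dist (A.resolvent l x) x = d at *
    have h2 : (l : ℝ) * (2 * d * -(w.g (vec 1 x (A.resolvent l x)))) ≤ l * (2 * d * C) := by
      gcongr
      linarith
    have h3 : d * d ≤ d * (l * C) := by nlinarith
    exact le_of_mul_le_mul_left h3 h0

theorem dist_iterate_resolvent_self_le (hmono : A.IsMonotone) (hsurj : A.Surjectivity) {x : X}
    {C : ℝ} {l : ℝ≥0} (hC : dist (A.resolvent l x) x ≤ l * C) (n : ℕ) :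
    dist ((A.resolvent l)^[n] x) x ≤ n * l * C := by
  induction n with
  | zero => simp
  | succ n ih =>
    rw [Function.iterate_succ_apply]
    refine (dist_triangle _ ((A.resolvent l)^[n] x) _).trans ?_
    have := dist_iterate_resolvent_le hmono hsurj l n (A.resolvent l x) x
    push_cast
    linarith

/-! ### The Crandall-Liggett estimate and the generated semigroup. -/

/-- The Crandall-Liggett estimate, in Kobayashi's form. -/
theorem dist_iterate_iterate_sq_le (hmono : A.IsMonotone) (hsurj : A.Surjectivity) {x : X}
    {C : ℝ} (hC : ∀ l : ℝ≥0, dist (A.resolvent l x) x ≤ l * C) (l m : ℝ≥0) (i j : ℕ) :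
    dist ((A.resolvent l)^[i] x) ((A.resolvent m)^[j] x) ^ 2 ≤
      C ^ 2 * ((i * l - j * m) ^ 2 + i * l ^ 2 + j * m ^ 2) := by
  have boundary : ∀ (l : ℝ≥0) (i : ℕ), dist ((A.resolvent l)^[i] x) x ^ 2 ≤
      C ^ 2 * ((i * l) ^ 2 + i * l ^ 2) := by
    intro l i
    have h1 := pow_le_pow_left₀ dist_nonneg (dist_iterate_resolvent_self_le hmono hsurj (hC l) i) 2
    have h2 : 0 ≤ C ^ 2 * (i * (l : ℝ) ^ 2) := by positivity
    nlinarith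
  -- The induction step divides by `l + m`; if the sum vanishes, both resolvents are the identity.
  rcases eq_or_ne (l + m) 0 with h0 | h0
  · obtain ⟨rfl, rfl⟩ := add_eq_zero.1 h0
    have hid : A.resolvent 0 = id := funext resolvent_zero
    simp [hid]
  have hlm : (0 : ℝ) < l + m := by
    have : (0 : ℝ≥0) < l + m := by positivity
    exact_mod_cast this
  induction i generalizing j with
  | zero => simpa [dist_comm] using boundary m j
  | succ i ihi =>
    induction j with
    | zero => simpa using boundary l (i + 1)
    | succ j ihj =>
      have h := dist_resolvent_sq_le hmono hsurj l m ((A.resolvent l)^[i] x)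
        ((A.resolvent m)^[j] x)
      simp only [← Function.iterate_succ_apply'] at h
      have h1 := mul_le_mul_of_nonneg_left (ihi (j + 1)) m.2
      have h2 := mul_le_mul_of_nonneg_left ihj l.2
      refine le_of_mul_le_mul_left ?_ hlm
      have p1 : 0 ≤ (m : ℝ) * dist ((A.resolvent l)^[i + 1] x) ((A.resolvent l)^[i] x) ^ 2 := by
        positivity
      have p2 : 0 ≤ (l : ℝ) * dist ((A.resolvent m)^[j + 1] x) ((A.resolvent m)^[j] x) ^ 2 := by
        positivity
      -- The quadratic bound solves the recursion with equality, which dictates its form; the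
      -- discarded residuals `p1` and `p2` are nonnegative.
      have h3 : (l + m : ℝ) * (C ^ 2 * (((i + 1 : ℕ) * l - (j + 1 : ℕ) * m) ^ 2
          + (i + 1 : ℕ) * l ^ 2 + (j + 1 : ℕ) * m ^ 2)) =
          m * (C ^ 2 * ((i * l - (j + 1 : ℕ) * m) ^ 2 + i * l ^ 2 + (j + 1 : ℕ) * m ^ 2)) +
          l * (C ^ 2 * (((i + 1 : ℕ) * l - j * m) ^ 2 + (i + 1 : ℕ) * l ^ 2 + j * m ^ 2)) := by
        push_cast; ring
      rw [h3]
      change (m : ℝ) * _ ≤ m * _ at h1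
      change (l : ℝ) * _ ≤ l * _ at h2
      linarith

/-- Two discretization schemes with the same limit time are asymptotically equal. -/
theorem tendsto_dist_iterate_resolvent (hmono : A.IsMonotone) (hsurj : A.Surjectivity) {x : X}
    (hx : x ∈ closure A.dom) {ι : Type*} {F : Filter ι} {s : ℝ} {l m : ι → ℝ≥0} {i j : ι → ℕ}
    (hl : Tendsto (fun k => (i k * l k : ℝ)) F (𝓝 s))
    (hl2 : Tendsto (fun k => (i k * l k ^ 2 : ℝ)) F (𝓝 0))
    (hm : Tendsto (fun k => (j k * m k : ℝ)) F (𝓝 s))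
    (hm2 : Tendsto (fun k => (j k * m k ^ 2 : ℝ)) F (𝓝 0)) :
    Tendsto (fun k => dist ((A.resolvent (l k))^[i k] x) ((A.resolvent (m k))^[j k] x)) F
      (𝓝 0) := by
  rw [Metric.tendsto_nhds]
  intro ε hε
  -- The estimate needs a point of the domain. Moving to `y` costs `ε / 4` in each scheme by
  -- nonexpansiveness, and the schemes started at `y` differ by less than `ε / 4`.
  obtain ⟨y, hy, hxy⟩ := Metric.mem_closure_iff.1 hx (ε / 4) (by positivity)
  obtain ⟨C, hC⟩ := exists_dist_resolvent_self_le hmono hsurj hy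
  have h0 : Tendsto (fun k => (C : ℝ) ^ 2 * ((i k * l k - j k * m k : ℝ) ^ 2
      + i k * l k ^ 2 + j k * m k ^ 2)) F (𝓝 (C ^ 2 * ((s - s) ^ 2 + 0 + 0))) :=
    ((((hl.sub hm).pow 2).add hl2).add hm2).const_mul _
  simp only [sub_self, ne_eq, OfNat.ofNat_ne_zero, not_false_eq_true, zero_pow, add_zero,
    mul_zero] at h0
  filter_upwards [h0.eventually_lt_const (by positivity : 0 < (ε / 4) ^ 2)] with k hk
  have h1 := (dist_iterate_iterate_sq_le hmono hsurj hC (l k) (m k) (i k) (j k)).trans_lt hk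
  have h2 := lt_of_pow_lt_pow_left₀ 2 (by positivity) h1
  have h3 := dist_iterate_resolvent_le hmono hsurj (l k) (i k) x y
  have h4 := dist_iterate_resolvent_le hmono hsurj (m k) (j k) y x
  rw [dist_comm y x] at h4
  have h5 := dist_triangle4 ((A.resolvent (l k))^[i k] x) ((A.resolvent (l k))^[i k] y)
    ((A.resolvent (m k))^[j k] y) ((A.resolvent (m k))^[j k] x)
  rw [Real.dist_0_eq_abs, abs_of_nonneg dist_nonneg]
  linarith

theorem tendsto_nat_mul_div (t : ℝ≥0) :
    Tendsto (fun k : ℕ => (k * (t / k : ℝ≥0) : ℝ)) atTop (𝓝 t) := by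
  refine tendsto_const_nhds.congr' ?_
  filter_upwards [eventually_gt_atTop 0] with k hk
  push_cast
  field_simp

theorem tendsto_nat_mul_div_sq (t : ℝ≥0) :
    Tendsto (fun k : ℕ => (k * (t / k : ℝ≥0) ^ 2 : ℝ)) atTop (𝓝 0) := by
  refine (tendsto_const_div_atTop_nhds_zero_nat ((t : ℝ) ^ 2)).congr' ?_
  filter_upwards [eventually_gt_atTop 0] with k hk
  push_cast
  field_simp

theorem tendsto_approx [CompleteSpace X] (hmono : A.IsMonotone) (hsurj : A.Surjectivity) {x : X}
    (hx : x ∈ closure A.dom) (t : ℝ≥0) :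
    Tendsto (A.approx t x) atTop (𝓝 (A.semigroup t x)) := by
  have hc : CauchySeq (A.approx t x) := by
    rw [cauchySeq_iff_tendsto_dist_atTop_0]
    rw [← prod_atTop_atTop_eq]
    exact tendsto_dist_iterate_resolvent hmono hsurj hx
      ((tendsto_nat_mul_div t).comp tendsto_fst) ((tendsto_nat_mul_div_sq t).comp tendsto_fst)
      ((tendsto_nat_mul_div t).comp tendsto_snd) ((tendsto_nat_mul_div_sq t).comp tendsto_snd)
  exact tendsto_nhds_limUnder (cauchySeq_tendsto_of_complete hc)

theorem antitone_dist_semigroup [CompleteSpace X] (hmono : A.IsMonotone)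
    (hsurj : A.Surjectivity) {x : X} (hx : x ∈ closure A.dom) {q : X} (hq : q ∈ A.zeros) :
    Antitone fun t => dist (A.semigroup t x) q := by
  intro s t hst
  have ht := tendsto_approx hmono hsurj hx t
  have hs := tendsto_approx hmono hsurj hx s
  rcases eq_or_ne t 0 with rfl | ht0
  · rw [nonpos_iff_eq_zero.1 hst]
  have htp : (0 : ℝ) < t := by positivity
  -- With step `t / k`, about `n k` steps reach time `s`. Since `n k ≤ k`, both times lie on one
  -- orbit of iterates, where the distance to `q` decreases.
  set n : ℕ → ℕ := fun k => ⌊(k * (s / t) : ℝ≥0)⌋₊ with hn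
  have hnk : ∀ k, n k ≤ k := fun k => Nat.floor_le_of_le
    (mul_le_of_le_one_right (by positivity) (div_le_one_of_le₀ hst (by positivity)))
  have hn1 : Tendsto (fun k : ℕ => (n k * (t / k : ℝ≥0) : ℝ)) atTop (𝓝 s) := by
    have h1 : Tendsto (fun k : ℕ => (s - t / k : ℝ)) atTop (𝓝 (s - 0)) :=
      tendsto_const_nhds.sub (tendsto_const_div_atTop_nhds_zero_nat (t : ℝ))
    rw [sub_zero] at h1
    refine tendsto_of_tendsto_of_tendsto_of_le_of_le' h1 tendsto_const_nhds ?_ ?_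
    · filter_upwards [eventually_gt_atTop 0] with k hk
      have hk' : (0 : ℝ) < k := by positivity
      have h2 : ((k * (s / t) : ℝ≥0) : ℝ) < n k + 1 := by
        exact_mod_cast Nat.lt_floor_add_one (k * (s / t) : ℝ≥0)
      push_cast at h2 ⊢
      have h3 := mul_lt_mul_of_pos_right h2 (by positivity : (0 : ℝ) < t / k)
      have h4 : (k * (s / t) * (t / k) : ℝ) = s := by field_simp
      linarith
    · filter_upwards [eventually_gt_atTop 0] with k hk
      have hk' : (0 : ℝ) < k := by positivity
      have h2 : (n k : ℝ) ≤ ((k * (s / t) : ℝ≥0) : ℝ) := by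
        exact_mod_cast Nat.floor_le (a := (k * (s / t) : ℝ≥0)) zero_le
      push_cast at h2 ⊢
      have h3 := mul_le_mul_of_nonneg_right h2 (by positivity : (0 : ℝ) ≤ t / k)
      have h4 : (k * (s / t) * (t / k) : ℝ) = s := by field_simp
      linarith
  have hn2 : Tendsto (fun k : ℕ => (n k * (t / k : ℝ≥0) ^ 2 : ℝ)) atTop (𝓝 0) := by
    refine squeeze_zero (fun k => by positivity) (fun k => ?_) (tendsto_nat_mul_div_sq t)
    gcongr
    exact_mod_cast hnk k
  have hd := tendsto_dist_iterate_resolvent hmono hsurj hx hn1 hn2 (tendsto_nat_mul_div s)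
    (tendsto_nat_mul_div_sq s)
  have hs' : Tendsto (fun k : ℕ => (A.resolvent (t / k))^[n k] x) atTop
      (𝓝 (A.semigroup s x)) := by
    rw [tendsto_iff_dist_tendsto_zero] at hs ⊢
    have h5 := hd.add hs
    rw [add_zero] at h5
    exact squeeze_zero (fun _ => dist_nonneg) (fun k => dist_triangle _ _ _) h5
  exact le_of_tendsto_of_tendsto' (ht.dist tendsto_const_nhds) (hs'.dist tendsto_const_nhds)
    fun k => antitone_dist_iterate_resolvent hmono hsurj (t / k) x hq (hnk k)

end
end VectorField

/-! ### Asymptotic radii and regular subsequences. -/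

section
variable {X : Type*} [MetricSpace X]

/-- The asymptotic distance from a point to a sequence. -/
noncomputable def asympDist (u : ℕ → X) (y : X) : ℝ := limsup (fun k => dist y (u k)) atTop

/-- The asymptotic radius of a sequence. -/
noncomputable def asympRadius (u : ℕ → X) : ℝ := ⨅ y, asympDist u y

variable {u : ℕ → X}

theorem isBoundedUnder_dist (hu : Bornology.IsBounded (range u)) (y : X) :
    IsBoundedUnder (· ≤ ·) atTop (fun k => dist y (u k)) := by
  obtain ⟨r, hr⟩ := hu.subset_closedBall y
  refine ⟨r, eventually_map.2 (Eventually.of_forall fun k => ?_)⟩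
  simpa [dist_comm] using hr (mem_range_self k)

theorem isCoboundedUnder_dist (u : ℕ → X) (y : X) :
    IsCoboundedUnder (· ≤ ·) atTop (fun k => dist y (u k)) :=
  IsCoboundedUnder.of_frequently_ge (a := 0) (Frequently.of_forall fun _ => dist_nonneg)

theorem asympDist_le {y : X} {a : ℝ} (h : ∀ᶠ k in atTop, dist y (u k) ≤ a) :
    asympDist u y ≤ a :=
  limsup_le_of_le (isCoboundedUnder_dist u y) h

theorem eventually_dist_lt (hu : Bornology.IsBounded (range u)) {y : X} {a : ℝ}
    (h : asympDist u y < a) : ∀ᶠ k in atTop, dist y (u k) < a :=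
  eventually_lt_of_limsup_lt h (isBoundedUnder_dist hu y)

theorem asympDist_nonneg (hu : Bornology.IsBounded (range u)) (y : X) : 0 ≤ asympDist u y :=
  le_limsup_of_le (isBoundedUnder_dist hu y) fun _ h => by
    obtain ⟨k, hk⟩ := h.exists
    exact dist_nonneg.trans hk

theorem asympDist_le_add_dist (hu : Bornology.IsBounded (range u)) (y z : X) :
    asympDist u y ≤ asympDist u z + dist y z := by
  refine le_of_forall_pos_le_add fun ε hε => asympDist_le ?_
  filter_upwards [eventually_dist_lt hu (lt_add_of_pos_right (asympDist u z) hε)] with k hk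
  linarith [dist_triangle y z (u k)]

theorem asympDist_le_of_eventually_eq {v : ℕ → X} (hu : Bornology.IsBounded (range u))
    {φ : ℕ → ℕ} (hφ : Tendsto φ atTop atTop) (h : ∀ᶠ k in atTop, v k = u (φ k)) (y : X) :
    asympDist v y ≤ asympDist u y := by
  refine le_of_forall_pos_le_add fun ε hε => asympDist_le ?_
  filter_upwards [h, hφ.eventually (eventually_dist_lt hu
    (lt_add_of_pos_right (asympDist u y) hε))] with k hk h2
  rw [hk]
  exact h2.le

theorem bddBelow_asympDist (hu : Bornology.IsBounded (range u)) :
    BddBelow (range (asympDist u)) :=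
  ⟨0, by rintro _ ⟨y, rfl⟩; exact asympDist_nonneg hu y⟩

theorem asympRadius_le (hu : Bornology.IsBounded (range u)) (y : X) :
    asympRadius u ≤ asympDist u y :=
  ciInf_le (bddBelow_asympDist hu) y

theorem isBounded_range_comp (hu : Bornology.IsBounded (range u)) (φ : ℕ → ℕ) :
    Bornology.IsBounded (range (u ∘ φ)) :=
  hu.subset (range_comp_subset_range φ u)

theorem asympRadius_le_of_eventually_eq {v : ℕ → X} (hu : Bornology.IsBounded (range u))
    (hv : Bornology.IsBounded (range v)) {φ : ℕ → ℕ} (hφ : Tendsto φ atTop atTop)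
    (h : ∀ᶠ k in atTop, v k = u (φ k)) : asympRadius v ≤ asympRadius u := by
  have : Nonempty X := ⟨u 0⟩
  exact le_ciInf fun y => (asympRadius_le hv y).trans (asympDist_le_of_eventually_eq hu hφ h y)

/-- Bounded sequences have regular subsequences. -/
theorem exists_regular_subseq (hu : Bornology.IsBounded (range u)) :
    ∃ φ : ℕ → ℕ, StrictMono φ ∧ ∀ ψ : ℕ → ℕ, StrictMono ψ →
      asympRadius (u ∘ φ) ≤ asympRadius (u ∘ φ ∘ ψ) := by
  have : Nonempty X := ⟨u 0⟩
  have hnn : ∀ φ : ℕ → ℕ, 0 ≤ asympRadius (u ∘ φ) := fun φ =>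
    le_ciInf fun y => asympDist_nonneg (isBounded_range_comp hu φ) y
  -- Refine each time to within `1 / (n + 1)` of the least possible radius, then take the diagonal
  -- `δ`.
  have hstep : ∀ (φ : ℕ → ℕ) (n : ℕ), ∃ ψ : ℕ → ℕ, StrictMono ψ ∧ ∀ χ : ℕ → ℕ, StrictMono χ →
      asympRadius (u ∘ φ ∘ ψ) ≤ asympRadius (u ∘ φ ∘ χ) + 1 / (n + 1) := by
    intro φ n
    set S := (fun χ : ℕ → ℕ => asympRadius (u ∘ φ ∘ χ)) '' {χ | StrictMono χ}
    have hS : BddBelow S := ⟨0, by rintro _ ⟨χ, -, rfl⟩; exact hnn _⟩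
    have hne : S.Nonempty := ⟨_, id, strictMono_id, rfl⟩
    obtain ⟨_, ⟨ψ, hψ, rfl⟩, hlt⟩ :=
      exists_lt_of_csInf_lt hne (lt_add_of_pos_right (sInf S) (Nat.one_div_pos_of_nat (n := n)))
    refine ⟨ψ, hψ, fun χ hχ => hlt.le.trans ?_⟩
    gcongr
    exact csInf_le hS ⟨χ, hχ, rfl⟩
  choose ψ hψ hψr using hstep
  let Φ : ℕ → ℕ → ℕ := fun n => Nat.rec id (fun n φ => φ ∘ ψ φ n) n
  have hΦs : ∀ n, Φ (n + 1) = Φ n ∘ ψ (Φ n) n := fun n => rfl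
  have hΦ : ∀ n, StrictMono (Φ n) := by
    intro n
    induction n with
    | zero => exact strictMono_id
    | succ n ih => rw [hΦs]; exact ih.comp (hψ _ _)
  have hfac : ∀ n k, ∃ χ : ℕ → ℕ, StrictMono χ ∧ Φ (n + k) = Φ n ∘ χ := by
    intro n k
    induction k with
    | zero => exact ⟨id, strictMono_id, rfl⟩
    | succ k ih =>
      obtain ⟨χ, hχ, he⟩ := ih
      exact ⟨χ ∘ ψ (Φ (n + k)) (n + k), hχ.comp (hψ _ _), by rw [← add_assoc, hΦs, he]; rfl⟩
  have hmono : ∀ n k, Φ n k ≤ Φ (n + 1) k := fun n k => (hΦ n).monotone ((hψ _ _).id_le k)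
  set δ : ℕ → ℕ := fun n => Φ n n with hδ
  have hδm : StrictMono δ := strictMono_nat_of_lt_succ fun n =>
    (hmono n n).trans_lt (hΦ (n + 1) n.lt_succ_self)
  have hev : ∀ n, ∃ χ : ℕ → ℕ, StrictMono χ ∧ ∀ k, δ (n + k) = Φ n (χ k) := by
    intro n
    have hmem : ∀ k, ∃ a, δ (n + k) = Φ n a := fun k => by
      obtain ⟨χ, -, he⟩ := hfac n k
      exact ⟨χ (n + k), by rw [hδ]; simp only; rw [he]; rfl⟩
    choose χ hχ using hmem
    refine ⟨χ, fun a b hab => ?_, hχ⟩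
    rw [← (hΦ n).lt_iff_lt, ← hχ, ← hχ]
    exact hδm (by omega)
  refine ⟨δ, hδm, fun θ hθ => ?_⟩
  refine le_of_forall_pos_le_add fun ε hε => ?_
  obtain ⟨n, hn⟩ := exists_nat_one_div_lt hε
  have hsub : ∀ m, Tendsto (fun k : ℕ => k - m) atTop atTop := fun m => tendsto_sub_atTop_nat m
  have h1 : asympRadius (u ∘ δ) ≤ asympRadius (u ∘ Φ (n + 1)) := by
    obtain ⟨χ, hχ, he⟩ := hev (n + 1)
    refine asympRadius_le_of_eventually_eq (isBounded_range_comp hu _)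
      (isBounded_range_comp hu _) (hχ.tendsto_atTop.comp (hsub (n + 1))) ?_
    filter_upwards [eventually_ge_atTop (n + 1)] with k hk
    simp only [Function.comp_apply]
    rw [← he, Nat.add_sub_cancel' hk]
  obtain ⟨χ, hχ, he⟩ := hev n
  -- The diagonal factors through `Φ n` only from index `n` on, hence the shift by `n`.
  have hθn : ∀ k, n ≤ θ (n + k) := fun k => (Nat.le_add_right n k).trans (hθ.id_le _)
  have hχ' : StrictMono fun k => χ (θ (n + k) - n) := by
    intro a b hab
    refine hχ ?_
    have := hθ (show n + a < n + b by omega)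
    have := hθn a
    omega
  have h2 := hψr (Φ n) n _ hχ'
  have h3 : asympRadius (u ∘ Φ n ∘ fun k => χ (θ (n + k) - n)) ≤ asympRadius (u ∘ δ ∘ θ) := by
    refine asympRadius_le_of_eventually_eq (isBounded_range_comp hu _)
      (isBounded_range_comp hu _) (tendsto_atTop_mono (fun k => Nat.le_add_left k n) tendsto_id)
      (Eventually.of_forall fun k => ?_)
    simp only [Function.comp_apply]
    rw [← he, Nat.add_sub_cancel' (hθn k)]
  have h4 : asympRadius (u ∘ Φ (n + 1)) ≤ _ := h2
  linarith

end

/-! ### Δ-compactness and Opial's lemma. -/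

section
variable {X : Type*} [MetricSpace X] [CAT0Space X] [CompleteSpace X] {u : ℕ → X}

theorem exists_asympDist_eq_asympRadius (hu : Bornology.IsBounded (range u)) :
    ∃ z, asympDist u z = asympRadius u := by
  have : Nonempty X := ⟨u 0⟩
  set r := asympRadius u with hr
  have hr0 : 0 ≤ r := le_ciInf fun y => asympDist_nonneg hu y
  -- The midpoint of two near-minimizers has squared asymptotic distance at most `a ^ 2 - dist y z ^
  -- 2 / 4` yet at least `r ^ 2`; so minimizing sequences are Cauchy.
  have key : ∀ (a : ℝ) (y z : X), asympDist u y < a → asympDist u z < a →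
      dist y z ^ 2 ≤ 4 * (a ^ 2 - r ^ 2) := by
    intro a y z hy hz
    obtain ⟨m, hm⟩ := exists_midpoint_dist_sq_le y z
    have ha : 0 ≤ a := (asympDist_nonneg hu y).trans hy.le
    have hev : ∀ᶠ k in atTop, dist m (u k) ^ 2 ≤ a ^ 2 - dist y z ^ 2 / 4 := by
      filter_upwards [eventually_dist_lt hu hy, eventually_dist_lt hu hz] with k h1 h2
      have h3 := hm (u k)
      rw [dist_comm _ m, dist_comm _ y, dist_comm _ z] at h3
      have h4 := pow_le_pow_left₀ dist_nonneg h1.le 2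
      have h5 := pow_le_pow_left₀ dist_nonneg h2.le 2
      linarith
    have h0 : 0 ≤ a ^ 2 - dist y z ^ 2 / 4 := by
      obtain ⟨k, hk⟩ := hev.exists
      exact (sq_nonneg _).trans hk
    have h6 : asympDist u m ≤ √(a ^ 2 - dist y z ^ 2 / 4) :=
      asympDist_le (hev.mono fun k hk => Real.le_sqrt_of_sq_le hk)
    have h7 := (asympRadius_le hu m).trans h6
    have h8 := pow_le_pow_left₀ hr0 h7 2
    rw [Real.sq_sqrt h0] at h8
    linarith
  have hex : ∀ n : ℕ, ∃ y, asympDist u y < r + 1 / (n + 1) := fun n =>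
    exists_lt_of_ciInf_lt (lt_add_of_pos_right _ Nat.one_div_pos_of_nat)
  choose y hy using hex
  have hlim : Tendsto (fun n : ℕ => r + 1 / ((n : ℝ) + 1)) atTop (𝓝 r) := by
    simpa using tendsto_const_nhds.add (tendsto_one_div_add_atTop_nhds_zero_nat (𝕜 := ℝ))
  have hcauchy : CauchySeq y := by
    refine cauchySeq_of_le_tendsto_0
      (fun n : ℕ => √(4 * ((r + 1 / ((n : ℝ) + 1)) ^ 2 - r ^ 2))) (fun n m N hn hm => ?_) ?_
    · have hmon : ∀ k, N ≤ k → asympDist u (y k) < r + 1 / ((N : ℝ) + 1) := fun k hk =>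
        (hy k).trans_le (by gcongr)
      exact Real.le_sqrt_of_sq_le (key _ _ _ (hmon n hn) (hmon m hm))
    · have := (((hlim.pow 2).sub_const (r ^ 2)).const_mul 4).sqrt
      simpa using this
  obtain ⟨z, hz⟩ := cauchySeq_tendsto_of_complete hcauchy
  refine ⟨z, le_antisymm ?_ (asympRadius_le hu z)⟩
  have hz' : Tendsto (fun n : ℕ => r + 1 / ((n : ℝ) + 1) + dist z (y n)) atTop (𝓝 r) := by
    have h2 : Tendsto (fun n => dist z (y n)) atTop (𝓝 0) := by
      simpa using (tendsto_const_nhds (x := z)).dist hz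
    simpa using hlim.add h2
  exact ge_of_tendsto' hz' fun n =>
    (asympDist_le_add_dist hu z (y n)).trans (by linarith [hy n])

/-- Bounded sequences have Δ-convergent subsequences. -/
theorem exists_deltaConverges_subseq (hu : Bornology.IsBounded (range u)) :
    ∃ φ : ℕ → ℕ, StrictMono φ ∧ ∃ z, DeltaConverges (u ∘ φ) z := by
  obtain ⟨φ, hφ, hreg⟩ := exists_regular_subseq hu
  have hb := isBounded_range_comp hu φ
  obtain ⟨z, hz⟩ := exists_asympDist_eq_asympRadius hb
  refine ⟨φ, hφ, z, hb, fun ψ hψ y => ?_⟩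
  have hb' := isBounded_range_comp hb ψ
  calc asympDist ((u ∘ φ) ∘ ψ) z ≤ asympDist (u ∘ φ) z :=
        asympDist_le_of_eventually_eq hb hψ.tendsto_atTop (Eventually.of_forall fun _ => rfl) z
    _ = asympRadius (u ∘ φ) := hz
    _ ≤ asympRadius ((u ∘ φ) ∘ ψ) := hreg ψ hψ
    _ ≤ asympDist ((u ∘ φ) ∘ ψ) y := asympRadius_le hb' y

/-- Opial's lemma for Fejér monotone curves. -/
theorem exists_deltaConvergesAtInfinity {f : ℝ≥0 → X} {Z : Set X} (hZ : Z.Nonempty)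
    (hf : ∀ q ∈ Z, Antitone fun t => dist (f t) q)
    (hacc : ∀ z, IsDeltaAccumulationPoint f z → z ∈ Z) :
    ∃ z ∈ Z, DeltaConvergesAtInfinity f z := by
  have hbf : Bornology.IsBounded (range f) := by
    obtain ⟨q, hq⟩ := hZ
    refine (Metric.isBounded_closedBall (x := q) (r := dist (f 0) q)).subset ?_
    rintro _ ⟨t, rfl⟩
    exact hf q hq zero_le
  have hb : ∀ τ : ℕ → ℝ≥0, Bornology.IsBounded (range (f ∘ τ)) := fun τ =>
    hbf.subset (range_comp_subset_range τ f)
  have hlim : ∀ q ∈ Z, ∃ r, ∀ τ : ℕ → ℝ≥0, Tendsto τ atTop atTop →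
      limsup (fun k => dist q ((f ∘ τ) k)) atTop = r := by
    intro q hq
    refine ⟨⨅ t, dist (f t) q, fun τ hτ => Tendsto.limsup_eq ?_⟩
    have h := (tendsto_atTop_ciInf (hf q hq)
      ⟨0, by rintro _ ⟨t, rfl⟩; exact dist_nonneg⟩).comp hτ
    exact h.congr fun k => dist_comm _ _
  have hsub : ∀ τ : ℕ → ℝ≥0, Tendsto τ atTop atTop → ∃ φ : ℕ → ℕ, StrictMono φ ∧
      ∃ z ∈ Z, DeltaConverges (f ∘ τ ∘ φ) z := by
    intro τ hτ
    obtain ⟨φ, hφ, z, hz⟩ := exists_deltaConverges_subseq (hb τ)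
    exact ⟨φ, hφ, z, hacc z ⟨τ ∘ φ, hτ.comp hφ.tendsto_atTop, hz⟩, hz⟩
  have hnat : Tendsto (fun k : ℕ => (k : ℝ≥0)) atTop atTop := tendsto_natCast_atTop_atTop
  -- The candidate comes from integer times. For other times a second limit `z'` is compared with
  -- it: `z` is a center along its own sequence, so `r ≤ r'`, and `z'` is a center along the other.
  -- Uniqueness of centers is not needed.
  obtain ⟨φ, hφ, z, hzZ, hz⟩ := hsub _ hnat
  refine ⟨z, hzZ, fun τ hτ => ⟨hb τ, fun ψ hψ y => ?_⟩⟩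
  have hτψ := hτ.comp hψ.tendsto_atTop
  obtain ⟨χ, hχ, z', hzZ', hz'⟩ := hsub _ hτψ
  obtain ⟨r, hr⟩ := hlim z hzZ
  obtain ⟨r', hr'⟩ := hlim z' hzZ'
  have h1 : limsup (fun k => dist z ((f ∘ τ ∘ ψ) k)) atTop = r := hr _ hτψ
  have h2 : r ≤ r' := by
    have h := hz.2 id strictMono_id z'
    have hm := hnat.comp hφ.tendsto_atTop
    have e1 := hr _ hm
    have e2 := hr' _ hm
    rw [← e1, ← e2]
    exact h
  have h3 : r' ≤ limsup (fun k => dist y ((f ∘ (τ ∘ ψ) ∘ χ) k)) atTop := by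
    rw [← hr' _ (hτψ.comp hχ.tendsto_atTop)]
    exact hz'.2 id strictMono_id y
  have h4 : limsup (fun k => dist y ((f ∘ (τ ∘ ψ) ∘ χ) k)) atTop ≤
      limsup (fun k => dist y ((f ∘ τ ∘ ψ) k)) atTop :=
    asympDist_le_of_eventually_eq (hb (τ ∘ ψ)) hχ.tendsto_atTop
      (Eventually.of_forall fun _ => rfl) y
  exact h1.le.trans (h2.trans (h3.trans h4))

end
end Hadamard

theorem theorem5p4 {H : Type*} [MetricSpace H] [CompleteSpace H] [Hadamard.CAT0Space H]
    (hext : Hadamard.GeodesicExtensionProperty H)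
    (A : Hadamard.VectorField H) (hmono : A.IsMonotone) (hsurj : A.Surjectivity)
    (hzero : A.zeros.Nonempty) (x : H) (hx : x ∈ closure A.dom) :
    (∀ t : ℝ≥0, Tendsto (A.approx t x) atTop (𝓝 (A.semigroup t x))) ∧
    Bornology.IsBounded (range fun t : ℝ≥0 => A.semigroup t x) ∧
    ((∀ z : H, Hadamard.IsDeltaAccumulationPoint (fun t => A.semigroup t x) z → z ∈ A.zeros) →
      ∃ z ∈ A.zeros, Hadamard.DeltaConvergesAtInfinity (fun t => A.semigroup t x) z) := by
  have hf := fun q hq =>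
    Hadamard.VectorField.antitone_dist_semigroup hmono hsurj hx (q := q) hq
  refine ⟨Hadamard.VectorField.tendsto_approx hmono hsurj hx, ?_,
    Hadamard.exists_deltaConvergesAtInfinity hzero hf⟩
  obtain ⟨q, hq⟩ := hzero
  refine (Metric.isBounded_closedBall (x := q) (r := dist (A.semigroup 0 x) q)).subset ?_
  rintro _ ⟨t, rfl⟩
  exact hf q hq zero_le
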